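/- Let $n\geq 2$, let $F_n$ be the free group of rank $n$ with identity element $e$, and let $\theta\colon F_n\to F_n$ be an injective endomorphism. Let $w\in F_n\setminus\{e\}$ be an element that is not a proper power (that is, there are no $v\in F_n$ and integer $k\geq 2$ with $w=v^k$), and suppose that $\theta(w)=w^d$ for some integer $d$ with $|d|\geq 2$. Then $w$ is primitive in $F_n$, that is, $w$ is an element of some free basis of $F_n$. -/

import Mathlib

universe u

/-- `g` is a proper power in `G`: `g = v ^ k` for some `v` in `G` and some `k ≥ 2`. -/
def IsProperPower {G : Type u} [Group G] (g : G) : Prop :=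
  ∃ (v : G) (k : ℕ), 2 ≤ k ∧ g = v ^ k

/-- `g` is primitive in `G`: it is an element of some free basis of `G`.
(A free basis embeds into `G`, so index types in the universe of `G` suffice.) -/
def IsPrimitiveInFreeGroup {G : Type u} [Group G] (g : G) : Prop :=
  ∃ (ι : Type u) (b : FreeGroupBasis ι G) (i : ι), b i = g

/-! ### Primitivity under isomorphism and inversion -/

section Primitive

variable {G H : Type u} [Group G] [Group H]

/-! After a conjugation `w` is cyclically reduced. Iterating `θ` gives an injective `φ` with `φ w =
w ^ M` and `|M|` as large as desired. Consider the Schreier graph of `H = φ.range`. As `w` is not a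
proper power, `w ^ m ∈ H` only if `M ∣ m` (`dvd_of_zpow_eq_zpow`), so the loop at the base coset
reading `w ^ |M|` closes at no smaller positive power of `w`.

Since `H` has `n` generators, the finite graph traced by this loop has Euler characteristic at least
`1 - n` (`card_edges_add_one_le`), hence fewer than `2 * n` branch vertices. A long loop has a
stretch of the length of `w` that avoids them. If the first edge of that stretch were crossed again,
both passages would run together for a full period: in the same direction this makes them the same
passage, and in opposite directions the periodic word would be its own inverse. So some edge is
crossed exactly once (`exists_crossed_once`).

Then `H` is the free product of the loops avoiding that edge and the cyclic group of `w ^ |M|`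
(`isPrimitive_of_crosses_once`). Hence `w ^ M = φ w` is primitive in `H`, and `φ⁻¹` carries this
back to `w`. -/

theorem IsPrimitiveInFreeGroup.map {g : G} (hg : IsPrimitiveInFreeGroup g) (e : G ≃* H) :
    IsPrimitiveInFreeGroup (e g) := by
  obtain ⟨ι, b, i, rfl⟩ := hg
  exact ⟨ι, b.map e, i, rfl⟩

/-- The automorphism of a free group that inverts one generator and fixes the others. -/
noncomputable def FreeGroup.invertGenerator {ι : Type*} [DecidableEq ι] (i : ι) :
    FreeGroup ι ≃* FreeGroup ι :=
  have key : (FreeGroup.lift (Function.update FreeGroup.of i (FreeGroup.of i)⁻¹)).comp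
      (FreeGroup.lift (Function.update FreeGroup.of i (FreeGroup.of i)⁻¹)) =
      MonoidHom.id (FreeGroup ι) := by
    ext j
    by_cases h : j = i
    · subst h; simp
    · simp [h]
  MonoidHom.toMulEquiv _ _ key key

theorem IsPrimitiveInFreeGroup.inv {g : G} (hg : IsPrimitiveInFreeGroup g) :
    IsPrimitiveInFreeGroup g⁻¹ := by
  classical
  obtain ⟨ι, b, i, rfl⟩ := hg
  refine ⟨ι, .ofRepr (b.repr.trans (FreeGroup.invertGenerator i).symm), i, ?_⟩
  change b.repr.symm (FreeGroup.lift _ (FreeGroup.of i)) = (b.repr.symm (FreeGroup.of i))⁻¹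
  simp

end Primitive

/-! ### Schreier graphs, paths and holonomy -/

namespace FreeGroup

variable {α : Type u} {X : Type*} [MulAction (FreeGroup α) X]

/-- The inverse of a letter. -/
def flip (x : α × Bool) : α × Bool := (x.1, !x.2)

@[simp] theorem flip_flip (x : α × Bool) : flip (flip x) = x := by simp [flip]

theorem flip_ne (x : α × Bool) : flip x ≠ x := by
  rcases x with ⟨a, _ | _⟩ <;> simp [flip]

theorem mk_flip (x : α × Bool) : mk [flip x] = (mk [x])⁻¹ := rfl

/-- The edge of the Schreier graph of the action on `X` that is crossed when the letter `x` is read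
from the vertex `v`. The edge `(v, a)` leads from `v` to `of a • v`. -/
def edge (v : X) (x : α × Bool) : X × α := (bif x.2 then v else mk [x] • v, x.1)

@[simp] theorem edge_true (v : X) (a : α) : edge v (a, true) = (v, a) := rfl

theorem edge_flip (v : X) (x : α × Bool) : edge (mk [x] • v) (flip x) = edge v x := by
  rcases x with ⟨a, _ | _⟩
  · rfl
  · have : mk [flip (a, true)] • mk [(a, true)] • v = v := by rw [mk_flip, inv_smul_smul]
    simpa [edge, flip] using this

theorem edge_eq_iff {v v' : X} {x x' : α × Bool} :
    edge v x = edge v' x' ↔ (v = v' ∧ x = x') ∨ (v' = mk [x] • v ∧ x' = flip x) := by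
  constructor
  · rcases x with ⟨a, _ | _⟩ <;> rcases x' with ⟨a', _ | _⟩ <;>
      simp only [edge, cond_true, cond_false, Prod.mk.injEq, flip] <;> rintro ⟨h, rfl⟩
    · left; simpa using h
    · right; simp [← h]
    · right
      refine ⟨?_, by simp⟩
      rw [h, show (mk [(a, true)] : FreeGroup α) = (mk [(a, false)])⁻¹ from rfl, inv_smul_smul]
    · left; simpa using h
  · rintro (⟨rfl, rfl⟩ | ⟨rfl, rfl⟩)
    · rfl
    · rw [edge_flip]

/-- `PathIn S v g`: the element `g` is spelled by some word that, read from the vertex `v`,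
crosses only edges in `S`. -/
inductive PathIn (S : Set (X × α)) (v : X) : FreeGroup α → Prop
  | one : PathIn S v 1
  | cons (x : α × Bool) (g : FreeGroup α) : PathIn S v g → edge (g • v) x ∈ S →
      PathIn S v (mk [x] * g)

namespace PathIn

variable {S : Set (X × α)} {v : X} {g g' : FreeGroup α}

theorem trans (h : PathIn S v g) (h' : PathIn S (g • v) g') : PathIn S v (g' * g) := by
  induction h' with
  | one => simpa using h
  | cons x k _ hx ih =>
    rw [mul_assoc]
    exact .cons x _ ih (by rwa [mul_smul])

theorem single {x : α × Bool} (hx : edge v x ∈ S) : PathIn S v (mk [x]) := by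
  simpa using PathIn.cons x 1 .one (by simpa using hx)

theorem symm (h : PathIn S v g) : PathIn S (g • v) g⁻¹ := by
  induction h with
  | one => simpa using PathIn.one
  | cons x k _ hx ih =>
    rw [mul_inv_rev]
    refine trans (single (x := flip x) ?_) ?_
    · rwa [mul_smul, edge_flip]
    · rwa [mul_smul, inv_smul_smul]

end PathIn

theorem induction_mk_mul {C : FreeGroup α → Prop} (g : FreeGroup α) (one : C 1)
    (mul : ∀ x g, C g → C (mk [x] * g)) : C g :=
  Quot.inductionOn g fun L ↦ L.recOn one fun x _ ih ↦ mul x _ ih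

section Holonomy

variable {A : Type*} [Group A]

/-- The action on `X × A` that twists the action on `X` by an edge labelling with values in `A`. -/
def twist (c : X × α → A) : FreeGroup α →* Equiv.Perm (X × A) :=
  lift fun a ↦
    { toFun := fun y ↦ (of a • y.1, c (y.1, a) * y.2)
      invFun := fun y ↦ ((of a)⁻¹ • y.1, (c ((of a)⁻¹ • y.1, a))⁻¹ * y.2)
      left_inv := fun y ↦ by simp
      right_inv := fun y ↦ by simp }

/-- The product of the labels along the path read by `g` from the vertex `v`. -/
def holonomy (c : X × α → A) (g : FreeGroup α) (v : X) : A := (twist c g (v, 1)).2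

variable (c : X × α → A)

/-- Labels multiply on the left, so the twisted action commutes with right translation of `A`. -/
theorem twist_apply (g : FreeGroup α) (v : X) (t : A) :
    twist c g (v, t) = (g • v, holonomy c g v * t) := by
  have key : ∀ (v : X) (t t' : A), (twist c g (v, t)).1 = g • v ∧
      (twist c g (v, t * t')).2 = (twist c g (v, t)).2 * t' := by
    induction g using FreeGroup.induction_on with
    | C1 => simp
    | of a => simp [twist, mul_assoc]
    | inv_of a _ => simp [twist, mul_assoc, Equiv.Perm.inv_def, Equiv.symm]
    | mul g h ihg ihh =>
      intro v t t'
      have h2 : ∀ t, twist c h (v, t) = (h • v, (twist c h (v, t)).2) :=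
        fun t ↦ Prod.ext (ihh v t 1).1 rfl
      constructor
      · rw [_root_.map_mul, Equiv.Perm.mul_apply, h2, (ihg _ _ 1).1, mul_smul]
      · rw [_root_.map_mul, Equiv.Perm.mul_apply, Equiv.Perm.mul_apply, h2 (t * t'), (ihh v t t').2,
          (ihg _ _ _).2, ← h2 t]
  refine Prod.ext (key v t 1).1 ?_
  simpa [holonomy] using (key v 1 t).2

@[simp] theorem holonomy_one (v : X) : holonomy c 1 v = 1 := by simp [holonomy]

theorem holonomy_mul (g h : FreeGroup α) (v : X) :
    holonomy c (g * h) v = holonomy c g (h • v) * holonomy c h v := by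
  conv_lhs => rw [holonomy, _root_.map_mul, Equiv.Perm.mul_apply, twist_apply, twist_apply]
  simp

theorem holonomy_of (a : α) (v : X) : holonomy c (of a) v = c (v, a) := by
  simp [holonomy, twist]

theorem holonomy_inv (g : FreeGroup α) (v : X) :
    holonomy c g⁻¹ v = (holonomy c g (g⁻¹ • v))⁻¹ := by
  rw [eq_inv_iff_mul_eq_one]
  have := holonomy_mul c g⁻¹ g (g⁻¹ • v)
  simpa using this.symm

theorem holonomy_inv_of (a : α) (v : X) :
    holonomy c (of a)⁻¹ v = (c ((of a)⁻¹ • v, a))⁻¹ := by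
  rw [holonomy_inv, holonomy_of]

end Holonomy

end FreeGroup

/-! ### Loops that cross an edge once -/

namespace FreeGroup

variable {α : Type u} {X : Type*} [MulAction (FreeGroup α) X]

/-- The group of the loops at `b` that cross only edges in `S`. -/
def loopsIn (S : Set (X × α)) (b : X) : Subgroup (FreeGroup α) where
  carrier := {g | g • b = b ∧ PathIn S b g}
  one_mem' := ⟨one_smul _ _, .one⟩
  mul_mem' {g h} hg hh := ⟨by rw [mul_smul, hh.1, hg.1], hh.2.trans (by rw [hh.1]; exact hg.2)⟩
  inv_mem' {g} hg := ⟨by rw [inv_smul_eq_iff, hg.1], by have := hg.2.symm; rwa [hg.1] at this⟩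

theorem inv_mul_mul_mem_loopsIn {S : Set (X × α)} {b v : X} {g r r' : FreeGroup α}
    (hr : PathIn S b r) (hrv : r • b = v) (hg : PathIn S v g) (hr' : PathIn S b r')
    (hrv' : r' • b = g • v) : r'⁻¹ * g * r ∈ loopsIn S b := by
  subst hrv
  refine ⟨by rw [mul_smul, mul_smul, ← hrv', inv_smul_smul], ?_⟩
  rw [mul_assoc]
  refine (hr.trans hg).trans ?_
  rw [mul_smul, ← hrv']
  exact hr'.symm

/-- If a loop crosses an edge exactly once, then every vertex is reached without that edge. -/
theorem exists_pathIn_compl [MulAction.IsPretransitive (FreeGroup α) X] {b : X}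
    {p q : FreeGroup α} {a : α} (hp : PathIn {(p • b, a)}ᶜ b p)
    (hq : PathIn {(p • b, a)}ᶜ (of a • p • b) q) (hqb : q • of a • p • b = b) (v : X) :
    ∃ r : FreeGroup α, r • b = v ∧ PathIn {(p • b, a)}ᶜ b r ∧ (v = b → r = 1) := by
  by_cases hv : v = b
  · exact ⟨1, by simp [hv], .one, fun _ ↦ rfl⟩
  suffices ∃ r : FreeGroup α, r • b = v ∧ PathIn {(p • b, a)}ᶜ b r by
    obtain ⟨r, h₁, h₂⟩ := this
    exact ⟨r, h₁, h₂, fun h ↦ absurd h hv⟩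
  clear hv
  obtain ⟨g, rfl⟩ := MulAction.exists_smul_eq (FreeGroup α) b v
  induction g using induction_mk_mul with
  | one => exact ⟨1, rfl, .one⟩
  | mul x g ih =>
    obtain ⟨r, hr, hr'⟩ := ih
    by_cases hx : edge (r • b) x = (p • b, a)
    · rw [← edge_true, edge_eq_iff] at hx
      -- The deleted edge is bypassed along the rest of the loop: its far end is reached by `q⁻¹`,
      -- its near end by `p`.
      rcases hx with ⟨h, rfl⟩ | ⟨h, h'⟩
      · refine ⟨q⁻¹, ?_, ?_⟩
        · rw [inv_smul_eq_iff, mul_smul, ← hr, h]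
          exact hqb.symm
        · have := hq.symm
          rwa [hqb] at this
      · exact ⟨p, by rw [h, mul_smul, hr], hp⟩
    · exact ⟨mk [x] * r, by rw [mul_smul, mul_smul, hr], .cons x r hr' (by simpa using hx)⟩

/-- The stabilizer is the free product of `K`, the loops avoiding the edge, and the cyclic group of
the given loop. `K` is free by Nielsen–Schreier; the inverse of the obvious map from the free group
on a basis of `K` and one new letter is a holonomy. -/
theorem isPrimitive_of_crosses_once [MulAction.IsPretransitive (FreeGroup α) X] {b : X}
    {p q : FreeGroup α} {a : α} (hp : PathIn {(p • b, a)}ᶜ b p)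
    (hq : PathIn {(p • b, a)}ᶜ (of a • p • b) q)
    (h : q * of a * p ∈ MulAction.stabilizer (FreeGroup α) b) :
    IsPrimitiveInFreeGroup (⟨q * of a * p, h⟩ : MulAction.stabilizer (FreeGroup α) b) := by
  classical
  have hqb : q • of a • p • b = b := by
    simpa [MulAction.mem_stabilizer_iff, mul_smul] using h
  set e₀ : X × α := (p • b, a) with he₀
  choose r hrv hrS hr1 using exists_pathIn_compl hp hq hqb
  rw [← he₀] at hrS
  replace hr1 : r b = 1 := hr1 b rfl
  let K := loopsIn {e₀}ᶜ b
  let B := IsFreeGroup.basis K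
  let I := IsFreeGroup.Generators K
  let κ : K →* FreeGroup (Option I) := (FreeGroup.map some).comp B.repr.toMonoidHom
  let t : FreeGroup (Option I) := of none
  have hKst : ∀ g ∈ K, g ∈ MulAction.stabilizer (FreeGroup α) b := fun g hg ↦ hg.1
  let ψ : FreeGroup (Option I) →* MulAction.stabilizer (FreeGroup α) b :=
    lift fun o ↦ o.elim ⟨_, h⟩ fun i ↦ ⟨B i, hKst _ (B i).2⟩
  have hψκ : ∀ k : K, (ψ (κ k) : FreeGroup α) = k := by
    have : ((Subgroup.subtype _).comp ψ).comp κ = K.subtype :=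
      B.ext_hom _ _ fun i ↦ by simp [κ, ψ]
    exact fun k ↦ DFunLike.congr_fun this k
  have hψt : (ψ t : FreeGroup α) = q * of a * p := by simp [ψ, t]
  let κ' : FreeGroup α → FreeGroup (Option I) := fun g ↦ if hg : g ∈ K then κ ⟨g, hg⟩ else 1
  have κ'_of_mem : ∀ g (hg : g ∈ K), κ' g = κ ⟨g, hg⟩ := fun g hg ↦ dif_pos hg
  have κ'_mul : ∀ g g', g ∈ K → g' ∈ K → κ' (g * g') = κ' g * κ' g' := by
    intro g g' hg hg'
    rw [κ'_of_mem g hg, κ'_of_mem g' hg', κ'_of_mem _ (K.mul_mem hg hg'), ← _root_.map_mul]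
    rfl
  have κ'_one : κ' 1 = 1 := by
    rw [κ'_of_mem 1 K.one_mem]; exact _root_.map_one κ
  have hψκ' : ∀ g ∈ K, (ψ (κ' g) : FreeGroup α) = g := fun g hg ↦ by
    rw [κ'_of_mem g hg, hψκ]
  have memK : ∀ v g, PathIn {e₀}ᶜ v g → (r (g • v))⁻¹ * g * r v ∈ K := fun v g hg ↦
    inv_mul_mul_mem_loopsIn (hrS v) (hrv v) hg (hrS _) (hrv _)
  -- Each edge is closed to a loop at `b` by the paths `r`. The label of `e₀` is solved for so that
  -- `q * of a * p` has holonomy exactly `t`.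
  let c : X × α → FreeGroup (Option I) := fun e ↦
    if e = e₀ then (κ' (q * r (of a • p • b)))⁻¹ * t * (κ' ((r (p • b))⁻¹ * p))⁻¹
    else κ' ((r (of e.2 • e.1))⁻¹ * of e.2 * r e.1)
  have hpK : (r (p • b))⁻¹ * p ∈ K := by simpa [hr1] using memK b p hp
  have hqK : q * r (of a • p • b) ∈ K := by simpa [hqb, hr1] using memK _ q hq
  have mem_of_ne : ∀ (v : X) (x : α), (v, x) ≠ e₀ → (r (of x • v))⁻¹ * of x * r v ∈ K :=
    fun v x hx ↦ memK v (of x) (PathIn.single (x := (x, true)) hx)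
  have hψc : ∀ v x, (ψ (c (v, x)) : FreeGroup α) = (r (of x • v))⁻¹ * of x * r v := by
    intro v x
    by_cases hx : (v, x) = e₀
    · obtain ⟨rfl, rfl⟩ := Prod.mk.inj (hx.trans he₀)
      simp only [c, if_pos hx, _root_.map_mul, _root_.map_inv, Subgroup.coe_mul, Subgroup.coe_inv,
        hψκ' _ hpK, hψκ' _ hqK, hψt]
      group
    · simp only [c, if_neg hx]
      exact hψκ' _ (mem_of_ne v x hx)
  have hψhol : ∀ g v, (ψ (holonomy c g v) : FreeGroup α) = (r (g • v))⁻¹ * g * r v := by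
    intro g
    induction g using FreeGroup.induction_on with
    | C1 => simp
    | of x => intro v; rw [holonomy_of, hψc]
    | inv_of x _ =>
      intro v
      rw [holonomy_inv_of, _root_.map_inv, Subgroup.coe_inv, hψc, smul_inv_smul]
      group
    | mul g h ihg ihh =>
      intro v
      rw [holonomy_mul, _root_.map_mul, Subgroup.coe_mul, ihg, ihh, mul_smul]
      group
  have hol_mk : ∀ v x, edge v x ≠ e₀ →
      holonomy c (mk [x]) v = κ' ((r (mk [x] • v))⁻¹ * mk [x] * r v) := by
    rintro v ⟨x, _ | _⟩ hx
    · change holonomy c (of x)⁻¹ v = κ' ((r ((of x)⁻¹ • v))⁻¹ * (of x)⁻¹ * r v)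
      replace hx : ((of x)⁻¹ • v, x) ≠ e₀ := hx
      have h₁ := mem_of_ne _ _ hx
      rw [smul_inv_smul] at h₁
      rw [holonomy_inv_of, inv_eq_iff_mul_eq_one]
      simp only [c, if_neg hx, smul_inv_smul]
      rw [← κ'_mul _ _ h₁ (by convert K.inv_mem h₁ using 1; group)]
      convert κ'_one using 2
      group
    · change holonomy c (of x) v = κ' ((r (of x • v))⁻¹ * (of x) * r v)
      replace hx : (v, x) ≠ e₀ := hx
      rw [holonomy_of]
      simp only [c, if_neg hx]
  have hol_path : ∀ v g, PathIn {e₀}ᶜ v g →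
      holonomy c g v = κ' ((r (g • v))⁻¹ * g * r v) := by
    intro v g hg
    induction hg with
    | one => simp [κ'_one]
    | cons x k hk hx ih =>
      rw [holonomy_mul, ih, hol_mk _ _ hx, ← κ'_mul _ _ (memK _ _ (.single hx)) (memK _ _ hk),
        mul_smul]
      congr 1
      group
  have hol_loop : holonomy c (q * of a * p) b = t := by
    rw [holonomy_mul, holonomy_mul, hol_path _ _ hp, hol_path _ _ hq, holonomy_of, hqb, hr1]
    simp only [c, ← he₀, if_pos, inv_one, one_mul, mul_one]
    group
  let χ : MulAction.stabilizer (FreeGroup α) b →* FreeGroup (Option I) :=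
    { toFun := fun g ↦ holonomy c g b
      map_one' := by simp
      map_mul' := fun g g' ↦ by
        rw [Subgroup.coe_mul, holonomy_mul, MulAction.mem_stabilizer_iff.1 g'.2] }
  have h₁ : ψ.comp χ = MonoidHom.id _ := by
    ext g
    simp only [MonoidHom.comp_apply, MonoidHom.id_apply]
    refine (hψhol g b).trans ?_
    rw [MulAction.mem_stabilizer_iff.1 g.2, hr1]
    simp
  have h₂ : χ.comp ψ = MonoidHom.id _ := by
    ext o
    rcases o with _ | i
    · simpa [ψ, χ] using hol_loop
    · have : holonomy c (B i : FreeGroup α) b = of (some i) := by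
        rw [hol_path _ _ (B i).2.2, (B i).2.1, hr1, inv_one, one_mul, mul_one,
          κ'_of_mem _ (B i).2]
        simp [κ]
      simpa [ψ, χ] using this
  refine ⟨Option I, .ofRepr (MonoidHom.toMulEquiv χ ψ h₁ h₂), none, ?_⟩
  change ψ t = _
  exact Subtype.ext hψt

end FreeGroup

/-! ### The Euler characteristic bound -/

namespace FreeGroup

/-- The Euler characteristic bound: a finite subgraph of the Schreier graph of a subgroup generated
by `Fintype.card β` elements has at most that rank. -/
theorem card_edges_add_one_le {α β X : Type*} [MulAction (FreeGroup α) X] [Fintype β]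
    [MulAction.IsPretransitive (FreeGroup α) X] {b : X} (φ : FreeGroup β →* FreeGroup α)
    (hφ : MulAction.stabilizer (FreeGroup α) b = φ.range) (E : Finset (X × α)) (V : Finset X)
    (hb : b ∈ V) (hE : ∀ e ∈ E, e.1 ∈ V ∧ of e.2 • e.1 ∈ V) :
    E.card + 1 ≤ Fintype.card β + V.card := by
  classical
  let A := Multiplicative (ZMod 2)
  have hr : ∀ v : X, ∃ r : FreeGroup α, r • b = v ∧ (v = b → r = 1) := by
    intro v
    by_cases hv : v = b
    · exact ⟨1, by simp [hv], fun _ ↦ rfl⟩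
    · obtain ⟨r, hr⟩ := MulAction.exists_smul_eq (FreeGroup α) b v
      exact ⟨r, hr, fun h ↦ absurd h hv⟩
  choose r hrv hr1 using hr
  let c : (E → A) → X × α → A := fun f e ↦ if h : e ∈ E then f ⟨e, h⟩ else 1
  -- Edge labellings of `E` over a group of order two are counted: they are determined by the
  -- holonomies of the generators and of one path to each vertex of `V` other than `b`.
  let Φ : (E → A) → (β → A) × (V.erase b → A) := fun f ↦
    (fun i ↦ holonomy (c f) (φ (of i)) b, fun v ↦ holonomy (c f) (r v) b)
  have hΦ : Function.Injective Φ := by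
    intro f f' hff
    have h₁ : ∀ i, holonomy (c f) (φ (of i)) b = holonomy (c f') (φ (of i)) b :=
      fun i ↦ congrFun (congrArg Prod.fst hff) i
    have h₂ : ∀ v ∈ V, holonomy (c f) (r v) b = holonomy (c f') (r v) b := by
      intro v hv
      by_cases hvb : v = b
      · simp [hr1 v hvb]
      · exact congrFun (congrArg Prod.snd hff) ⟨v, Finset.mem_erase.2 ⟨hvb, hv⟩⟩
    have hφb : ∀ g, φ g • b = b := fun g ↦ by
      rw [← MulAction.mem_stabilizer_iff, hφ]; exact ⟨g, rfl⟩
    have h₃ : ∀ g, holonomy (c f) (φ g) b = holonomy (c f') (φ g) b := by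
      intro g
      induction g using FreeGroup.induction_on with
      | C1 => simp
      | of i => exact h₁ i
      | inv_of i ih =>
        have : ∀ g, (φ g)⁻¹ • b = b := fun g ↦ by rw [inv_smul_eq_iff, hφb]
        rw [_root_.map_inv, holonomy_inv, holonomy_inv, this, ih]
      | mul g h ihg ihh =>
        rw [_root_.map_mul, holonomy_mul, holonomy_mul, hφb, ihg, ihh]
    funext ⟨⟨v, a⟩, he⟩
    obtain ⟨hv, hav⟩ := hE _ he
    have hmem : (r (of a • v))⁻¹ * of a * r v ∈ φ.range := by
      rw [← hφ, MulAction.mem_stabilizer_iff, mul_smul, mul_smul, hrv, inv_smul_eq_iff, hrv]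
    obtain ⟨g, hg⟩ := hmem
    have key : of a * r v = r (of a • v) * φ g := by rw [hg]; group
    have h₄ : ∀ f, c f (v, a) * holonomy (c f) (r v) b =
        holonomy (c f) (r (of a • v)) b * holonomy (c f) (φ g) b := by
      intro f
      have := congrArg (fun g ↦ holonomy (c f) g b) key
      simpa only [holonomy_mul, holonomy_of, hφb, hrv] using this
    have h₅ : c f (v, a) = c f' (v, a) := by
      have h₆ := h₄ f
      rw [h₂ _ hv, h₂ _ hav, h₃, ← h₄ f'] at h₆
      exact mul_right_cancel h₆
    simpa [c, he] using h₅
  have hcard := Fintype.card_le_of_injective Φ hΦ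
  have hA : Fintype.card A = 2 := by
    rw [Fintype.card_multiplicative, ZMod.card]
  simp only [Fintype.card_fun, Fintype.card_prod, hA, Fintype.card_coe, ← pow_add] at hcard
  have := (Nat.pow_le_pow_iff_right (by norm_num)).1 hcard
  rw [Finset.card_erase_of_mem hb] at this
  have := Finset.card_pos.2 ⟨b, hb⟩
  omega

/-! ### Centres and roots in free groups -/

section Roots

variable {ι : Type*}

theorem subsingleton_of_forall_commute {z : FreeGroup ι} (hz : z ≠ 1)
    (h : ∀ g, z * g = g * z) : Subsingleton ι := by
  classical
  by_contra hι
  rw [not_subsingleton_iff_nontrivial] at hι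
  obtain ⟨x, l, hl⟩ : ∃ x l, z.toWord = x :: l :=
    List.exists_cons_of_ne_nil fun h ↦ hz (toWord_eq_nil_iff.1 h)
  obtain ⟨y, hy⟩ := exists_ne x.1
  have h₁ : (of y * z).toWord = (y, true) :: x :: l := by
    rw [toWord_mul, toWord_of, List.singleton_append, reduce.cons, reduce_toWord, hl]
    simp [hy]
  -- By length nothing cancels in `z * of y`, so its word starts with `x`, while that of `of y * z`
  -- starts with `y`.
  have h₂ := toWord_mul_sublist z (of y)
  rw [h, h₁, hl, toWord_of] at h₂
  have h₃ := h₂.eq_of_length (by simp)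
  simp only [List.cons_append, List.cons.injEq] at h₃
  exact hy (congrArg Prod.fst h₃.1)

/-- The subgroup generated by `u` and `w` is free and has the nontrivial central element `w ^ j`, so
it is cyclic; `w`, not being a proper power, generates it. -/
theorem dvd_of_zpow_eq_zpow {u w : FreeGroup ι} {M j : ℤ} (hw : w ≠ 1)
    (hpow : ¬ IsProperPower w) (h : u ^ M = w ^ j) : M ∣ j := by
  by_cases hj : j = 0
  · simp [hj]
  let G := Subgroup.closure {u, w}
  let B := IsFreeGroup.basis G
  have hu : u ∈ G := Subgroup.subset_closure (by simp)
  have hwG : w ∈ G := Subgroup.subset_closure (by simp)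
  have hz : w ^ j ≠ 1 := fun h ↦ hw ((IsMulTorsionFree.zpow_eq_one_iff_left hj).1 h)
  have hcomm : ∀ g ∈ G, w ^ j * g = g * w ^ j := by
    intro g hg
    have : G ≤ Subgroup.centralizer {w ^ j} := by
      rw [Subgroup.closure_le]
      rintro x (rfl | rfl)
      · rw [← h]
        simp only [SetLike.mem_coe, Subgroup.mem_centralizer_singleton_iff]
        exact (Commute.refl _).zpow_right _
      · simp only [SetLike.mem_coe, Subgroup.mem_centralizer_singleton_iff]
        exact (Commute.refl _).zpow_right _
    exact (Subgroup.mem_centralizer_singleton_iff.1 (this hg)).symm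
  let z : G := ⟨w ^ j, G.zpow_mem hwG j⟩
  have hsub : Subsingleton (IsFreeGroup.Generators G) := by
    refine subsingleton_of_forall_commute (z := B.repr z) ?_ ?_
    · rw [ne_eq, MulEquiv.map_eq_one_iff]
      exact fun h ↦ hz (congrArg Subtype.val h)
    · intro g
      obtain ⟨g, rfl⟩ := B.repr.surjective g
      rw [← _root_.map_mul, ← _root_.map_mul]
      exact congrArg _ (Subtype.ext (hcomm g g.2))
  obtain ⟨c, hc⟩ : ∃ c : FreeGroup ι, ∀ g ∈ G, ∃ k : ℤ, g = c ^ k := by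
    suffices ∃ c : G, ∀ g : G, ∃ k : ℤ, g = c ^ k by
      obtain ⟨c, hc⟩ := this
      refine ⟨c, fun g hg ↦ ?_⟩
      obtain ⟨k, hk⟩ := hc ⟨g, hg⟩
      exact ⟨k, by simpa using congrArg Subtype.val hk⟩
    suffices ∃ c : FreeGroup (IsFreeGroup.Generators G), ∀ g, ∃ k : ℤ, g = c ^ k by
      obtain ⟨c, hc⟩ := this
      refine ⟨B.repr.symm c, fun g ↦ ?_⟩
      obtain ⟨k, hk⟩ := hc (B.repr g)
      exact ⟨k, by rw [← map_zpow, ← hk, MulEquiv.symm_apply_apply]⟩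
    rcases isEmpty_or_nonempty (IsFreeGroup.Generators G) with hI | ⟨⟨i⟩⟩
    · exact ⟨1, fun g ↦ ⟨0, Subsingleton.elim _ _⟩⟩
    · refine ⟨of i, fun g ↦ ?_⟩
      induction g using FreeGroup.induction_on with
      | C1 => exact ⟨0, by simp⟩
      | of x => exact ⟨1, by rw [Subsingleton.elim x i, zpow_one]⟩
      | inv_of x _ => exact ⟨-1, by rw [Subsingleton.elim x i, zpow_neg_one]⟩
      | mul x y hx hy =>
        obtain ⟨k, rfl⟩ := hx
        obtain ⟨l, rfl⟩ := hy
        exact ⟨k + l, by rw [zpow_add]⟩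
  obtain ⟨x, rfl⟩ := hc u hu
  obtain ⟨y, rfl⟩ := hc w hwG
  have hc1 : c ≠ 1 := by rintro rfl; simp at hw
  rw [← zpow_mul, ← zpow_mul] at h
  have h' : x * M = y * j := by
    rw [← sub_eq_zero]
    by_contra hne
    refine hc1 ((IsMulTorsionFree.zpow_eq_one_iff_left hne).1 ?_)
    rw [zpow_sub, h, mul_inv_cancel]
  have hy : y.natAbs = 1 := by
    by_contra hy1
    have hy0 : y ≠ 0 := by rintro rfl; simp at hw
    have : 2 ≤ y.natAbs := by omega
    apply hpow
    rcases Int.natAbs_eq y with hy | hy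
    · exact ⟨c, y.natAbs, this, by rw [← zpow_natCast, ← hy]⟩
    · exact ⟨c⁻¹, y.natAbs, this, by rw [← zpow_natCast, inv_zpow', ← hy]⟩
  have : M ∣ y * j := ⟨x, by rw [← h', mul_comm]⟩
  rwa [(Int.isUnit_iff_natAbs_eq.2 hy).dvd_mul_left] at this

end Roots

end FreeGroup

/-! ### Periodic reduced sequences -/

namespace FreeGroup

theorem finite_range_of_periodic {Y : Type*} {f : ℤ → Y} {T : ℤ} (hT : 0 < T)
    (hf : Function.Periodic f T) : (Set.range f).Finite := by
  rw [← hf.image_Ioc hT 0]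
  exact (Set.finite_Ioc _ _).image f

section Sequences

variable {α : Type*} {s : ℤ → α × Bool} {L : ℤ}

/-- A periodic bi-infinite sequence that agrees with its translate along one period is invariant
under that translation. -/
theorem periodic_sub_of_agree (hL : 0 < L) (hper : Function.Periodic s L) {p q : ℤ}
    (h : ∀ j, 0 ≤ j → j ≤ L → s (p + j) = s (q + j)) : Function.Periodic s (q - p) := by
  intro i
  have h₁ := h ((i - p) % L) (Int.emod_nonneg _ hL.ne') (Int.emod_lt_of_pos _ hL).le
  have h₂ : (i - p) % L = i - p - (i - p) / L * L := by
    have := Int.emod_add_mul_ediv (i - p) L; linarith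
  have h₃ : ∀ i k : ℤ, s (i - k * L) = s i := fun i k ↦ hper.sub_zsmul_eq k (x := i)
  rw [h₂, show p + (i - p - (i - p) / L * L) = i - (i - p) / L * L by ring, h₃,
    show q + (i - p - (i - p) / L * L) = i + (q - p) - (i - p) / L * L by ring, h₃] at h₁
  exact h₁.symm

/-- A periodic reduced bi-infinite word does not run along its own inverse for a full period. -/
theorem not_agree_flip (hL : 0 < L) (hper : Function.Periodic s L)
    (hs : ∀ i, s (i + 1) ≠ flip (s i)) {p q : ℤ} :
    ¬ ∀ j, 0 ≤ j → j ≤ L → s (q - j) = flip (s (p + j)) := by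
  intro h
  have key : ∀ i, s (p + q - i) = flip (s i) := by
    intro i
    have h₁ := h ((i - p) % L) (Int.emod_nonneg _ hL.ne') (Int.emod_lt_of_pos _ hL).le
    have h₂ : (i - p) % L = i - p - (i - p) / L * L := by
      have := Int.emod_add_mul_ediv (i - p) L; linarith
    have h₃ : ∀ i k : ℤ, s (i - k * L) = s i := fun i k ↦ hper.sub_zsmul_eq k (x := i)
    have h₄ : ∀ i k : ℤ, s (i + k * L) = s i := fun i k ↦ hper.zsmul k i
    rwa [h₂, show p + (i - p - (i - p) / L * L) = i - (i - p) / L * L by ring, h₃,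
      show q - (i - p - (i - p) / L * L) = p + q - i + (i - p) / L * L by ring, h₄] at h₁
  -- The reflection `i ↦ p + q - i` either fixes an integer or swaps two neighbours; a letter equal
  -- to its inverse or a cancelling pair results.
  obtain ⟨c, hc | hc⟩ := Int.even_or_odd' (p + q)
  · have := key c
    rw [hc, show 2 * c - c = c by ring] at this
    exact flip_ne _ this.symm
  · have := key c
    rw [hc, show 2 * c + 1 - c = c + 1 by ring] at this
    exact hs c this

end Sequences

/-! ### Branch vertices and edges crossed once -/

section Branching

variable {α X : Type*} [MulAction (FreeGroup α) X] {s : ℤ → α × Bool} {v : ℤ → X}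

/-- The edges crossed by the path with vertices `v i` and letters `s i`. -/
def crossed (s : ℤ → α × Bool) (v : ℤ → X) : Set (X × α) := Set.range fun i ↦ edge (v i) (s i)

theorem edge_mem_crossed (i : ℤ) : edge (v i) (s i) ∈ crossed s v := ⟨i, rfl⟩

theorem edge_flip_mem_crossed (hv : ∀ i, v (i + 1) = mk [s i] • v i) (i : ℤ) :
    edge (v (i + 1)) (flip (s i)) ∈ crossed s v := by
  rw [hv, edge_flip]
  exact edge_mem_crossed i

variable [Fintype α]

open Classical in
/-- The letters that lead from the vertex `x` along an edge of `S`. -/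
noncomputable def link (S : Set (X × α)) (x : X) : Finset (α × Bool) :=
  Finset.univ.filter fun y ↦ edge x y ∈ S

theorem mem_link {S : Set (X × α)} {x : X} {y : α × Bool} : y ∈ link S x ↔ edge x y ∈ S := by
  simp [link]

/-- Each edge has two orientations, and an orientation determines the vertex it leaves and the
letter read. -/
theorem sum_card_link_le (E : Finset (X × α)) (V : Finset X) :
    ∑ x ∈ V, (link (E : Set (X × α)) x).card ≤ 2 * E.card := by
  classical
  rw [← Finset.card_sigma, mul_comm, ← Fintype.card_bool, ← Finset.card_univ,
    ← Finset.card_product]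
  refine Finset.card_le_card_of_injOn (fun y ↦ (edge y.1 y.2, y.2.2)) ?_ ?_
  · rintro ⟨x, y⟩ hy
    simp only [Finset.coe_sigma, Set.mem_sigma_iff, Finset.mem_coe, mem_link] at hy
    simpa using hy.2
  · rintro ⟨x, y⟩ _ ⟨x', y'⟩ _ h
    obtain ⟨h₁, h₂⟩ := Prod.mk.inj h
    rcases edge_eq_iff.1 h₁ with ⟨h₃, h₄⟩ | ⟨_, h₄⟩
    · dsimp only at h₃ h₄
      rw [h₃, h₄]
    · dsimp only at h₂ h₄
      simp [h₄, flip] at h₂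

theorem two_le_card_link (hv : ∀ i, v (i + 1) = mk [s i] • v i)
    (hs : ∀ i, s (i + 1) ≠ flip (s i)) (i : ℤ) : 2 ≤ (link (crossed s v) (v i)).card := by
  classical
  have h₁ := edge_flip_mem_crossed hv (i - 1)
  have h₂ := hs (i - 1)
  rw [sub_add_cancel] at h₁ h₂
  rw [← Finset.card_pair h₂]
  refine Finset.card_le_card ?_
  simp only [Finset.insert_subset_iff, Finset.singleton_subset_iff, mem_link]
  exact ⟨edge_mem_crossed i, h₁⟩

/-- At a vertex where at most two edges meet, a reduced path has no choice. -/
theorem eq_of_card_link_lt (hv : ∀ i, v (i + 1) = mk [s i] • v i)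
    (hs : ∀ i, s (i + 1) ≠ flip (s i)) {i : ℤ}
    (hi : (link (crossed s v) (v (i + 1))).card < 3) {y : α × Bool}
    (hy : edge (v (i + 1)) y ∈ crossed s v) (hne : y ≠ flip (s i)) : y = s (i + 1) := by
  classical
  by_contra hy'
  have : ({y, s (i + 1), flip (s i)} : Finset (α × Bool)).card = 3 :=
    Finset.card_eq_three.2 ⟨_, _, _, hy', hne, hs i, rfl⟩
  have h : ({y, s (i + 1), flip (s i)} : Finset (α × Bool)) ⊆ link (crossed s v) (v (i + 1)) := by
    simp only [Finset.insert_subset_iff, Finset.singleton_subset_iff, mem_link]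
    exact ⟨hy, edge_mem_crossed _, edge_flip_mem_crossed hv i⟩
  have := Finset.card_le_card h
  omega

theorem agree_of_unbranched (hv : ∀ i, v (i + 1) = mk [s i] • v i)
    (hs : ∀ i, s (i + 1) ≠ flip (s i)) {p q : ℤ} {m : ℕ} (h₁ : v p = v q) (h₂ : s p = s q)
    (h : ∀ j : ℕ, j < m → (link (crossed s v) (v (p + j + 1))).card < 3) :
    ∀ j : ℕ, j ≤ m → s (p + j) = s (q + j) ∧ v (p + j) = v (q + j) := by
  intro j
  induction j with
  | zero => intro _; simpa using ⟨h₂, h₁⟩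
  | succ j ih =>
    intro hj
    obtain ⟨hsj, hvj⟩ := ih (by omega)
    have hv' : v (p + j + 1) = v (q + j + 1) := by rw [hv, hv, hsj, hvj]
    push_cast
    rw [← add_assoc, ← add_assoc]
    refine ⟨(eq_of_card_link_lt hv hs (h j (by omega)) ?_ ?_).symm, hv'⟩
    · rw [hv']; exact edge_mem_crossed _
    · rw [hsj]; exact hs _

theorem agree_flip_of_unbranched (hv : ∀ i, v (i + 1) = mk [s i] • v i)
    (hs : ∀ i, s (i + 1) ≠ flip (s i)) {p q : ℤ} {m : ℕ} (h₁ : v q = v (p + 1))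
    (h₂ : s q = flip (s p))
    (h : ∀ j : ℕ, j < m → (link (crossed s v) (v (p + j + 1))).card < 3) :
    ∀ j : ℕ, j ≤ m → s (q - j) = flip (s (p + j)) ∧ v (q - j) = v (p + j + 1) := by
  intro j
  induction j with
  | zero => intro _; simpa using ⟨h₂, h₁⟩
  | succ j ih =>
    intro hj
    obtain ⟨hsj, hvj⟩ := ih (by omega)
    push_cast
    rw [← add_assoc, ← sub_sub]
    have hq : v (q - j) = mk [s (q - j - 1)] • v (q - j - 1) := by rw [← hv, sub_add_cancel]
    have hred := hs (q - j - 1)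
    rw [sub_add_cancel] at hred
    have hs' : flip (s (q - j - 1)) = s (p + j + 1) := by
      refine eq_of_card_link_lt hv hs (h j (by omega)) ?_ ?_
      · rw [← hvj]
        have := edge_flip_mem_crossed hv (q - j - 1)
        rwa [sub_add_cancel] at this
      · rw [← hsj]; exact hred.symm
    refine ⟨by rw [← hs', flip_flip], ?_⟩
    rw [hv (p + j + 1), ← hs', ← hvj, hq, mk_flip, inv_smul_smul]

/-- A long closed path whose label is periodic, in a Schreier graph of bounded rank, crosses some
edge exactly once. -/
theorem exists_crossed_once (hv : ∀ i, v (i + 1) = mk [s i] • v i)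
    (hs : ∀ i, s (i + 1) ≠ flip (s i)) {L N n : ℕ} (hL : 0 < L) (hper : Function.Periodic s L)
    (hmin : ∀ c, Function.Periodic s c → (L : ℤ) ∣ c)
    (hloop : ∀ i m : ℤ, v (i + m * L) = v i ↔ (N : ℤ) ∣ m)
    (hrank : ∀ (E : Finset (X × α)) (V : Finset X), v 0 ∈ V →
      (∀ e ∈ E, e.1 ∈ V ∧ of e.2 • e.1 ∈ V) → E.card + 1 ≤ n + V.card)
    (hN : 2 * n * L < N) :
    ∃ i, ∀ j, edge (v j) (s j) = edge (v i) (s i) → ((N * L : ℕ) : ℤ) ∣ j - i := by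
  classical
  by_contra! hcon
  have hT : 0 < ((N * L : ℕ) : ℤ) := by
    have : 0 < N := by omega
    positivity
  have hvT : Function.Periodic v ((N * L : ℕ) : ℤ) := fun i ↦ by
    push_cast; exact (hloop i N).2 dvd_rfl
  have hsT : Function.Periodic s ((N * L : ℕ) : ℤ) := fun i ↦ by
    push_cast; exact hper.int_mul N i
  have hVfin := finite_range_of_periodic hT hvT
  have hEfin : (crossed s v).Finite :=
    finite_range_of_periodic hT fun i ↦ by simp only [hvT i, hsT i]
  set V := hVfin.toFinset with hV
  set E := hEfin.toFinset with hE
  have hEc : (E : Set (X × α)) = crossed s v := hEfin.coe_toFinset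
  have hmemV : ∀ i, v i ∈ V := fun i ↦ by simp [hV]
  have hEV : E.card + 1 ≤ n + V.card := by
    refine hrank E V (hmemV 0) fun e he ↦ ?_
    rw [← Finset.mem_coe, hEc] at he
    obtain ⟨i, rfl⟩ := he
    dsimp only
    have h₁ : v i ∈ V ∧ mk [s i] • v i ∈ V := ⟨hmemV i, by rw [← hv]; exact hmemV _⟩
    rcases hsi : s i with ⟨a, _ | _⟩ <;> rw [hsi] at h₁
    · refine ⟨h₁.2, ?_⟩
      change of a • (of a)⁻¹ • v i ∈ V
      rw [smul_inv_smul]; exact h₁.1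
    · exact h₁
  have hsum := sum_card_link_le E V
  rw [hEc] at hsum
  let B := V.filter fun x ↦ 3 ≤ (link (crossed s v) x).card
  -- Every vertex of the path has degree at least two; a branch vertex contributes at least one
  -- more. With `hEV` and `hsum` this gives `B.card ≤ 2 * n`.
  have hB : B.card + 2 * V.card ≤ ∑ x ∈ V, (link (crossed s v) x).card := by
    rw [Finset.card_filter, mul_comm, ← smul_eq_mul, ← Finset.sum_const, ← Finset.sum_add_distrib]
    refine Finset.sum_le_sum fun x hx ↦ ?_
    obtain ⟨i, rfl⟩ := hVfin.mem_toFinset.1 hx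
    have := two_le_card_link hv hs i
    split_ifs <;> omega
  -- Each window of `L` consecutive vertices contains a branch vertex: otherwise the second crossing
  -- supplied by `hcon` agrees with the first, directly or reversed, for a full period.
  have hwin : ∀ p : ℤ, ∃ j : Fin L, v (p + j + 1) ∈ B := by
    intro p
    by_contra! hp
    have hp' : ∀ j : ℕ, j < L → (link (crossed s v) (v (p + j + 1))).card < 3 := by
      intro j hj
      have := hp ⟨j, hj⟩
      simpa [B, hmemV] using this
    obtain ⟨q, hq, hqp⟩ := hcon p
    rcases edge_eq_iff.1 hq.symm with ⟨h₁, h₂⟩ | ⟨h₁, h₂⟩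
    · have hag := agree_of_unbranched hv hs h₁ h₂ hp'
      have hag' : ∀ j : ℤ, 0 ≤ j → j ≤ L → s (p + j) = s (q + j) := by
        intro j hj hjL
        lift j to ℕ using hj
        exact (hag j (by omega)).1
      obtain ⟨m, hm⟩ := hmin _ (periodic_sub_of_agree (by omega) hper hag')
      obtain ⟨k, rfl⟩ := (hloop p m).1 (by
        rw [mul_comm, ← hm, add_sub_cancel, h₁])
      exact hqp ⟨k, by rw [hm]; push_cast; ring⟩
    · have hag := agree_flip_of_unbranched hv hs (by rw [h₁, hv]) h₂ hp'
      refine not_agree_flip (p := p) (q := q) (by omega) hper hs fun j hj hjL ↦ ?_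
      lift j to ℕ using hj
      exact (hag j (by omega)).1
  choose J hJ using hwin
  -- Vertices at equal offsets in different windows, among the `N` starting at multiples of `L`, are
  -- distinct by `hloop`. Hence `N ≤ L * B.card`, against `hN`.
  have hcard : Fintype.card (Fin N) ≤ Fintype.card (Fin L × B) := by
    refine Fintype.card_le_of_injective
      (fun k : Fin N ↦ (J (k * L), (⟨_, hJ (k * L)⟩ : B))) fun k k' hkk ↦ ?_
    obtain ⟨h₁, h₂⟩ := Prod.mk.inj hkk
    replace h₂ := congrArg Subtype.val h₂
    dsimp only at h₂
    rw [h₁] at h₂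
    have h₃ := (hloop ((k' : ℕ) * L + (J ((k' : ℕ) * L) : ℕ) + 1) ((k : ℕ) - (k' : ℕ))).1 (by
      rw [← h₂]; congr 1; ring)
    have h₄ := Int.eq_zero_of_abs_lt_dvd h₃ (by
      rw [abs_lt]; constructor <;> have := k.2 <;> have := k'.2 <;> omega)
    exact Fin.ext (by omega)
  rw [Fintype.card_fin, Fintype.card_prod, Fintype.card_fin, Fintype.card_coe] at hcard
  have : B.card ≤ 2 * n := by omega
  have : L * B.card ≤ 2 * n * L := by
    rw [mul_comm]; exact Nat.mul_le_mul_right _ this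
  omega

end Branching

end FreeGroup

/-! ### The periodic path of a cyclically reduced word -/

namespace FreeGroup

variable {α : Type u}

theorem ne_flip_of_imp {x y : α × Bool} (h : x.1 = y.1 → x.2 = y.2) : x ≠ flip y := by
  rintro rfl
  simp [flip] at h

/-- The powers of a cyclically reduced word, read as a bi-infinite periodic reduced word from right
to left, with its partial products. -/
theorem exists_periodic_word {l : List (α × Bool)} (hl : IsCyclicallyReduced l) (hne : l ≠ []) :
    ∃ (s : ℤ → α × Bool) (P : ℤ → FreeGroup α), P 0 = 1 ∧ (∀ i, P (i + 1) = mk [s i] * P i) ∧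
      Function.Periodic s l.length ∧ P l.length = mk l ∧ ∀ i, s (i + 1) ≠ flip (s i) := by
  have hL : 0 < l.length := List.length_pos_iff.2 hne
  have hL' : (0 : ℤ) < l.length := by exact_mod_cast hL
  have hr : ∀ i : ℤ, (i % l.length).toNat < l.length := fun i ↦ by
    have := Int.emod_lt_of_pos i hL'
    have := Int.emod_nonneg i hL'.ne'
    omega
  have hsucc : ∀ i : ℤ, ((i % l.length).toNat + 1 < l.length ∧
      ((i + 1) % l.length).toNat = (i % l.length).toNat + 1 ∧ (i + 1) / l.length = i / l.length) ∨
      ((i % l.length).toNat + 1 = l.length ∧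
      ((i + 1) % l.length).toNat = 0 ∧ (i + 1) / l.length = i / l.length + 1) := by
    intro i
    have h₁ := Int.emod_lt_of_pos i hL'
    have h₂ := Int.emod_nonneg i hL'.ne'
    have h₃ := Int.emod_add_mul_ediv i l.length
    by_cases h : i % l.length + 1 < l.length
    · have := (Int.ediv_emod_unique hL' (a := i + 1) (r := i % l.length + 1)
        (q := i / l.length)).2 ⟨by linarith, by omega, h⟩
      left
      rw [this.1, this.2]
      exact ⟨by omega, by omega, rfl⟩
    · have h' : i % l.length + 1 = l.length := by omega
      have := (Int.ediv_emod_unique hL' (a := i + 1) (r := 0)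
        (q := i / l.length + 1)).2 ⟨by linarith, le_rfl, hL'⟩
      right
      rw [this.1, this.2]
      exact ⟨by omega, by simp, rfl⟩
  have hdrop : ∀ (r : ℕ) (_ : r < l.length),
      l.drop (l.length - (r + 1)) = l[l.length - 1 - r] :: l.drop (l.length - r) := by
    intro r h
    rw [show l.length - (r + 1) = l.length - 1 - r by omega,
      List.drop_eq_getElem_cons (by omega), show l.length - 1 - r + 1 = l.length - r by omega]
  -- The action is on the left, so letters are read from the end of `l`: `P i` is a suffix of length
  -- `i % l.length` times a power of `mk l`.
  refine ⟨fun i ↦ l[l.length - 1 - (i % l.length).toNat],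
    fun i ↦ mk (l.drop (l.length - (i % l.length).toNat)) * mk l ^ (i / l.length), ?_, ?_, ?_, ?_,
    ?_⟩
  · simp [one_eq_mk]
  · intro i
    dsimp only
    rcases hsucc i with ⟨h₁, h₂, h₃⟩ | ⟨h₁, h₂, h₃⟩
    · rw [h₂, h₃, ← mul_assoc, mul_mk, List.singleton_append, hdrop _ (hr i)]
    · have h₄ := hdrop _ (hr i)
      rw [h₁, Nat.sub_self, List.drop_zero] at h₄
      rw [h₂, h₃, add_comm, zpow_one_add, Nat.sub_zero, List.drop_length, ← one_eq_mk, one_mul,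
        ← mul_assoc, mul_mk, List.singleton_append, ← h₄]
  · intro i
    simp
  · dsimp only
    rw [Int.emod_self, Int.ediv_self hL'.ne']
    simp [← one_eq_mk]
  · intro i
    dsimp only
    apply ne_flip_of_imp
    rcases hsucc i with ⟨h₁, h₂, h₃⟩ | ⟨h₁, h₂, h₃⟩
    · have := List.isChain_iff_getElem.1 hl.1 (l.length - 1 - (i % l.length).toNat - 1) (by omega)
      simp only [h₂, Nat.sub_add_eq]
      simpa only [Nat.sub_add_cancel (show 1 ≤ l.length - 1 - (i % l.length).toNat by omega)]
        using this
    -- At the wrap-around the last letter of `l` follows the first; here cyclic reducedness is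
    -- needed.
    · refine hl.2 _ ?_ _ ?_
      · simp [h₂, List.getLast?_eq_getElem?]
      · simp [List.head?_eq_getElem?, show l.length - 1 - (i % l.length).toNat = 0 by omega]

section PartialProducts

variable {s : ℤ → α × Bool} {P : ℤ → FreeGroup α}

theorem partialProduct_add (h0 : P 0 = 1) (hP : ∀ i, P (i + 1) = mk [s i] * P i) {c : ℤ}
    (hc : Function.Periodic s c) (i : ℤ) : P (i + c) = P i * P c := by
  induction i using Int.induction_on with
  | zero => simp [h0]
  | succ i ih => rw [add_right_comm, hP, hP, hc, ih, mul_assoc]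
  | pred i ih =>
    have h₁ := hP (-(i : ℤ) - 1)
    have h₂ := hP (-(i : ℤ) - 1 + c)
    rw [sub_add_cancel] at h₁
    rw [add_right_comm, sub_add_cancel, hc, ih, h₁, mul_assoc] at h₂
    exact (mul_left_cancel h₂).symm

theorem partialProduct_mul (h0 : P 0 = 1) (hP : ∀ i, P (i + 1) = mk [s i] * P i) {c : ℤ}
    (hc : Function.Periodic s c) (k : ℤ) : P (k * c) = P c ^ k := by
  induction k using Int.induction_on with
  | zero => simp [h0]
  | succ k ih => rw [add_one_mul, partialProduct_add h0 hP hc, ih, zpow_add_one]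
  | pred k ih =>
    have h₁ := partialProduct_add h0 hP hc ((-(k : ℤ) - 1) * c)
    rw [← add_one_mul, sub_add_cancel, ih] at h₁
    rw [zpow_sub_one, h₁, mul_inv_cancel_right]

theorem partialProduct_add_mul (h0 : P 0 = 1) (hP : ∀ i, P (i + 1) = mk [s i] * P i) {c : ℤ}
    (hc : Function.Periodic s c) (i k : ℤ) : P (i + k * c) = P i * P c ^ k := by
  rw [← smul_eq_mul, partialProduct_add h0 hP (hc.zsmul k), smul_eq_mul,
    partialProduct_mul h0 hP hc]

/-- By Bézout the gcd of two periods is a period, so `P L` is a power of the partial product at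
`Int.gcd L c`, with exponent necessarily one. -/
theorem dvd_of_periodic (h0 : P 0 = 1) (hP : ∀ i, P (i + 1) = mk [s i] * P i) {L : ℕ}
    (hL : 0 < L) (hper : Function.Periodic s L) (hpow : ¬ IsProperPower (P L)) {c : ℤ}
    (hc : Function.Periodic s c) : (L : ℤ) ∣ c := by
  have hg : Function.Periodic s (Int.gcd L c) := by
    rw [Int.gcd_eq_gcd_ab, mul_comm, mul_comm c]
    exact (hper.int_mul _).add_period (hc.int_mul _)
  obtain ⟨m, hm⟩ := Int.gcd_dvd_left (L : ℤ) c
  have hgpos : 0 < Int.gcd L c := Int.gcd_pos_of_ne_zero_left _ (by omega)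
  have hmpos : 0 < m := by
    by_contra! h
    have : (Int.gcd L c : ℤ) * m ≤ 0 := mul_nonpos_of_nonneg_of_nonpos (by omega) h
    omega
  have hm1 : m = 1 := by
    by_contra hne
    refine hpow ⟨P (Int.gcd L c), m.toNat, by omega, ?_⟩
    conv_lhs => rw [hm, mul_comm, partialProduct_mul h0 hP hg]
    rw [← zpow_natCast, Int.toNat_of_nonneg hmpos.le]
  rw [hm1, mul_one] at hm
  rw [hm]
  exact Int.gcd_dvd_right _ _

variable {X : Type*} [MulAction (FreeGroup α) X]

theorem pathIn_partialProduct (hP : ∀ i, P (i + 1) = mk [s i] * P i) {S : Set (X × α)} {b : X}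
    (i : ℤ) (k : ℕ) (h : ∀ j, i ≤ j → j < i + k → edge (P j • b) (s j) ∈ S) :
    PathIn S (P i • b) (P (i + k) * (P i)⁻¹) := by
  induction k with
  | zero => simpa using PathIn.one
  | succ k ih =>
    push_cast
    rw [← add_assoc, hP, mul_assoc]
    refine .cons _ _ (ih fun j h₁ h₂ ↦ h j h₁ (by push_cast; omega)) ?_
    rw [mul_smul, inv_smul_smul]
    exact h _ (by omega) (by push_cast; omega)

theorem isPrimitive_of_crossed_once [MulAction.IsPretransitive (FreeGroup α) X]
    (h0 : P 0 = 1) (hP : ∀ i, P (i + 1) = mk [s i] * P i) {b : X} {T : ℕ} (hT : 0 < T)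
    (hsT : Function.Periodic s T) (hTb : P T ∈ MulAction.stabilizer (FreeGroup α) b) {i : ℤ}
    (hi : ∀ j, edge (P j • b) (s j) = edge (P i • b) (s i) → (T : ℤ) ∣ j - i) :
    IsPrimitiveInFreeGroup (⟨P T, hTb⟩ : MulAction.stabilizer (FreeGroup α) b) := by
  have hTb' : P T • b = b := hTb
  have hT' : (0 : ℤ) < T := by exact_mod_cast hT
  have hPT : ∀ i k : ℤ, P (i + k * T) • b = P i • b := by
    intro i k
    rw [partialProduct_add_mul h0 hP hsT, mul_smul]
    congr 1
    exact (Subgroup.zpow_mem _ hTb k : _ ∈ MulAction.stabilizer (FreeGroup α) b)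
  wlog hi0 : 0 ≤ i ∧ i < T generalizing i
  · have hmod : i % T = i + (-(i / T)) * T := by
      have := Int.emod_add_mul_ediv i T
      linarith
    refine this (i := i % T) ?_ ⟨Int.emod_nonneg _ hT'.ne', Int.emod_lt_of_pos _ hT'⟩
    intro j hj
    rw [hmod, hPT, show s (i + (-(i / T)) * T) = s i from hsT.int_mul _ i] at hj
    rw [hmod, ← sub_sub]
    exact (hi j hj).sub (Dvd.intro_left _ rfl)
  obtain ⟨hi₀, hiT⟩ := hi0
  have hne : ∀ j : ℤ, 0 ≤ j → j < T → j ≠ i →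
      edge (P j • b) (s j) ∈ ({edge (P i • b) (s i)}ᶜ : Set (X × α)) := by
    intro j hj₀ hjT hji hj
    have := Int.eq_zero_of_abs_lt_dvd (hi j hj) (by rw [abs_lt]; constructor <;> omega)
    omega
  have hp : PathIn {edge (P i • b) (s i)}ᶜ b (P i) := by
    have := pathIn_partialProduct hP (S := {edge (P i • b) (s i)}ᶜ) (b := b) 0 i.toNat
      fun j h₁ h₂ ↦ hne j h₁ (by omega) (by omega)
    simpa [h0, hi₀] using this
  have hq : PathIn {edge (P i • b) (s i)}ᶜ (P (i + 1) • b) (P T * (P (i + 1))⁻¹) := by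
    have := pathIn_partialProduct hP (S := {edge (P i • b) (s i)}ᶜ) (b := b) (i + 1)
      (T - (i + 1)).toNat fun j h₁ h₂ ↦ hne j (by omega) (by omega) (by omega)
    rwa [show i + 1 + ((T - (i + 1)).toNat : ℤ) = T by omega] at this
  have hqb : (P T * (P (i + 1))⁻¹) • P (i + 1) • b = b := by
    rw [mul_smul, inv_smul_smul, hTb']
  have hPi := hP i
  rcases hsi : s i with ⟨a, _ | _⟩ <;> rw [hsi] at hp hq hPi
  -- The edge is crossed backwards, so the reversed loop is used and the result inverted.
  · have hPi' : P (i + 1) = (of a)⁻¹ * P i := hPi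
    have he : edge (P i • b) (a, false) = ((P T * (P (i + 1))⁻¹)⁻¹ • b, a) := by
      rw [mul_inv_rev, inv_inv, mul_smul, inv_smul_eq_iff.2 hTb'.symm, hPi, mul_smul]
      rfl
    have hend : of a • (P T * (P (i + 1))⁻¹)⁻¹ • b = P i • b := by
      rw [mul_inv_rev, inv_inv, mul_smul, inv_smul_eq_iff.2 hTb'.symm, hPi', mul_smul,
        smul_inv_smul]
    have hq' := hq.symm
    have hp' := hp.symm
    rw [hqb, he] at hq'
    rw [he, ← hend] at hp'
    have heq : (P i)⁻¹ * of a * (P T * (P (i + 1))⁻¹)⁻¹ = (P T)⁻¹ := by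
      rw [hPi']; group
    have hmem : (P i)⁻¹ * of a * (P T * (P (i + 1))⁻¹)⁻¹ ∈
        MulAction.stabilizer (FreeGroup α) b := by
      rw [heq]; exact Subgroup.inv_mem _ hTb
    convert (isPrimitive_of_crosses_once hq' hp' hmem).inv using 1
    exact Subtype.ext (by simp only [heq, Subgroup.coe_inv, inv_inv])
  · rw [edge_true] at hp hq
    have hPi' : P (i + 1) = of a * P i := hPi
    have heq : P T * (P (i + 1))⁻¹ * of a * P i = P T := by
      rw [hPi']; group
    rw [show P (i + 1) • b = of a • P i • b by rw [hPi', mul_smul]] at hq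
    convert isPrimitive_of_crosses_once hp hq (by rwa [heq]) using 1
    exact Subtype.ext heq.symm

end PartialProducts

/-- If `φ` is injective and `φ w` is a sufficiently high power of the cyclically reduced element
`w`, which is not itself a proper power, then `w` is primitive. -/
theorem isPrimitive_of_map_eq_zpow [Fintype α] {l : List (α × Bool)} (hl : IsCyclicallyReduced l)
    (hne : l ≠ []) (hpow : ¬ IsProperPower (mk l)) (φ : FreeGroup α →* FreeGroup α)
    (hφ : Function.Injective φ) {M : ℤ} (hM : φ (mk l) = mk l ^ M)
    (hbig : 2 * Fintype.card α * l.length < M.natAbs) : IsPrimitiveInFreeGroup (mk l) := by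
  classical
  obtain ⟨s, P, h0, hP, hper, hPL, hs⟩ := exists_periodic_word hl hne
  have hL : 0 < l.length := List.length_pos_iff.2 hne
  have hw1 : mk l ≠ 1 := by
    intro h
    have := congrArg toWord h
    rw [toWord_mk, hl.1.reduce_eq, toWord_one] at this
    exact hne this
  let b : FreeGroup α ⧸ φ.range := ((1 : FreeGroup α) : FreeGroup α ⧸ φ.range)
  have hstab : MulAction.stabilizer (FreeGroup α) b = φ.range := MulAction.stabilizer_quotient _
  -- If `w ^ m = φ u`, then `φ (u ^ M) = w ^ (m * M) = φ (w ^ m)`, and injectivity gives `u ^ M = w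
  -- ^ m`.
  have hord : ∀ m : ℤ, mk l ^ m • b = b ↔ M ∣ m := by
    intro m
    rw [← MulAction.mem_stabilizer_iff, hstab]
    constructor
    · rintro ⟨u, hu⟩
      refine dvd_of_zpow_eq_zpow hw1 hpow (u := u) (hφ ?_)
      rw [map_zpow, map_zpow, hu, hM, ← zpow_mul, ← zpow_mul, mul_comm]
    · rintro ⟨k, rfl⟩
      exact ⟨mk l ^ k, by rw [map_zpow, hM, zpow_mul]⟩
  have hloop : ∀ i m : ℤ, P (i + m * l.length) • b = P i • b ↔ (M.natAbs : ℤ) ∣ m := by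
    intro i m
    rw [partialProduct_add_mul h0 hP hper, hPL, mul_smul,
      smul_left_cancel_iff, hord, Int.natAbs_dvd]
  obtain ⟨i, hi⟩ := exists_crossed_once (v := fun i ↦ P i • b) (n := Fintype.card α)
    (fun i ↦ by rw [hP, mul_smul]) hs hL hper
    (fun c hc ↦ dvd_of_periodic h0 hP hL hper (by rwa [hPL]) hc) hloop
    (fun E V hb hE ↦ card_edges_add_one_le φ hstab E V (by simpa [h0] using hb) hE) hbig
  have hPT : P ((M.natAbs * l.length : ℕ) : ℤ) = mk l ^ (M.natAbs : ℤ) := by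
    push_cast
    rw [partialProduct_mul h0 hP hper, hPL]
  have hmem : P ((M.natAbs * l.length : ℕ) : ℤ) ∈ MulAction.stabilizer (FreeGroup α) b := by
    rw [hPT, MulAction.mem_stabilizer_iff, hord]
    exact Int.dvd_natAbs.2 dvd_rfl
  have hprim := isPrimitive_of_crossed_once h0 hP (Nat.mul_pos (by omega) hL)
    (by push_cast; exact hper.int_mul _) hmem hi
  let e : MulAction.stabilizer (FreeGroup α) b ≃* FreeGroup α :=
    (MulEquiv.subgroupCongr hstab).trans (MonoidHom.ofInjective hφ).symm
  have he : ∀ g hg, φ (e ⟨g, hg⟩) = g := by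
    intro g hg
    have := (MonoidHom.ofInjective hφ).apply_symm_apply (MulEquiv.subgroupCongr hstab ⟨g, hg⟩)
    exact congrArg Subtype.val this
  have hfin := hprim.map e
  rcases Int.natAbs_eq M with hM' | hM'
  · convert hfin using 1
    apply hφ
    rw [he, hPT, hM, ← hM']
  · convert hfin.inv using 1
    apply hφ
    rw [_root_.map_inv, he, hPT, hM, ← zpow_neg, ← hM']

theorem isPrimitive_of_map_eq_zpow_of_two_le [Fintype α] (θ : FreeGroup α →* FreeGroup α)
    (hθ : Function.Injective θ) {l : List (α × Bool)} (hl : IsCyclicallyReduced l) (hne : l ≠ [])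
    (hpow : ¬ IsProperPower (mk l)) {d : ℤ} (hd : 2 ≤ |d|) (h : θ (mk l) = mk l ^ d) :
    IsPrimitiveInFreeGroup (mk l) := by
  have hiter : ∀ k : ℕ, ∃ φ : FreeGroup α →* FreeGroup α, Function.Injective φ ∧
      φ (mk l) = mk l ^ (d ^ k) := by
    intro k
    induction k with
    | zero => exact ⟨MonoidHom.id _, Function.injective_id, by simp⟩
    | succ k ih =>
      obtain ⟨φ, hφ, hk⟩ := ih
      refine ⟨θ.comp φ, hθ.comp hφ, ?_⟩
      rw [MonoidHom.comp_apply, hk, map_zpow, h, ← zpow_mul, pow_succ']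
  -- Any `k` satisfies `k < |d| ^ k`, so the required bound itself serves as the number of
  -- iterations.
  obtain ⟨φ, hφ, hk⟩ := hiter (2 * Fintype.card α * l.length)
  refine isPrimitive_of_map_eq_zpow hl hne hpow φ hφ hk ?_
  rw [Int.natAbs_pow]
  refine Nat.lt_pow_self ?_
  rw [Int.abs_eq_natAbs] at hd
  omega

end FreeGroup

/-! ### Reduction to a cyclically reduced word -/

theorem mainTheorem5 (n : ℕ) (hn : 2 ≤ n)
    (θ : FreeGroup (Fin n) →* FreeGroup (Fin n)) (hθ : Function.Injective θ)
    (w : FreeGroup (Fin n)) (hw : w ≠ 1) (d : ℤ) (hd : 2 ≤ |d|)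
    (hθw : θ w = w ^ d) (hpow : ¬ IsProperPower w) :
    IsPrimitiveInFreeGroup w := by
  let g := FreeGroup.mk (FreeGroup.reduceCyclically.conjugator w.toWord)
  let l := FreeGroup.reduceCyclically w.toWord
  have hl : FreeGroup.IsCyclicallyReduced l :=
    FreeGroup.reduceCyclically.isCyclicallyReduced FreeGroup.isReduced_toWord
  have hconj : MulAut.conj g (FreeGroup.mk l) = w := by
    have := congrArg FreeGroup.mk
      (FreeGroup.reduceCyclically.conj_conjugator_reduceCyclically w.toWord)
    rwa [← FreeGroup.mul_mk, ← FreeGroup.mul_mk, ← FreeGroup.inv_mk, FreeGroup.mk_toWord] at this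
  have hne : l ≠ [] := by
    intro h
    rw [h, ← FreeGroup.one_eq_mk, map_one] at hconj
    exact hw hconj.symm
  rw [← hconj]
  refine IsPrimitiveInFreeGroup.map ?_ (MulAut.conj g)
  -- Conjugating `θ` by `g` turns the relation for `w` into the same relation for its cyclic
  -- reduction.
  let θ' : FreeGroup (Fin n) →* FreeGroup (Fin n) :=
    ((MulAut.conj g).symm.toMonoidHom.comp θ).comp (MulAut.conj g).toMonoidHom
  refine FreeGroup.isPrimitive_of_map_eq_zpow_of_two_le θ' ?_ hl hne ?_ hd ?_
  · exact ((MulAut.conj g).symm.injective.comp hθ).comp (MulAut.conj g).injective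
  · rintro ⟨v, k, hk, hv⟩
    exact hpow ⟨MulAut.conj g v, k, hk, by rw [← map_pow, ← hv, hconj]⟩
  · change (MulAut.conj g).symm (θ (MulAut.conj g (FreeGroup.mk l))) = _
    rw [hconj, hθw, map_zpow, ← hconj, MulEquiv.symm_apply_apply]
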